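/- **Definitions.** For a linearly ordered set $S$ with least element $\bot$, the character $\chi(S)$ is the least cardinal $\kappa>0$ (identified with its initial ordinal) for which there is a strictly decreasing map $f\colon\kappa+1\to S$ with $f(\kappa)=\bot$ such that for every $t\in S\setminus\{\bot\}$ there is $\alpha<\kappa$ with $f(\alpha)\le t$. For a linearly ordered Abelian group $G$, let $\mathrm{Arc}(G)$ be the linearly ordered set of Archimedean classes of positive elements of $G$ (the class of $x$ is at most the class of $y$ iff $x\le n y$ for some integer $n\ge 1$), and let $\mathrm{Arc}(G)_{\bot}$ be $\mathrm{Arc}(G)$ with a new least element adjoined. Let $\mathcal G_\kappa$ be the class of linearly ordered Abelian groups $G$ with $\chi(\mathrm{Arc}(G)_{\bot})=\kappa$, and $\mathcal F_\kappa$ the class of linearly ordered sets $S$ with least element and $\chi(S)=\kappa$. A $G$-metric on $X$ is a map $d\colon X\times X\to G_{\ge 0}$ that is symmetric, vanishes exactly on the diagonal and satisfies $d(x,y)\le d(x,z)+d(z,y)$. An $S$-ultrametric on $X$ is a symmetric map $d\colon X\times X\to S$ that takes the value $\bot$ exactly on the diagonal and satisfies $d(x,y)\le\max\{d(x,z),d(z,y)\}$.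 For a topological space $X$, $\mathrm{Met}(X;G)$ and $\mathrm{Ult}(X;S)$ denote the sets of $G$-metrics, respectively $S$-ultrametrics, for which the topology generated by the open balls of positive radius (radius $>0$, respectively $>\bot$) is the topology of $X$. A (proper) filter on $X$ is Cauchy for $d$ if for every $\varepsilon>0$ (respectively $\varepsilon>\bot$) it contains a set $A$ with $d(x,y)<\varepsilon$ for all $x,y\in A$; $(X,d)$ is complete if every Cauchy filter converges. A cardinal $\kappa$ is a metrizable gauge of $X$ if $\mathrm{Met}(X;G)\ne\emptyset$ for some $G\in\mathcal G_\kappa$. The space $X$ is finally $\kappa$-compact if every open cover of $X$ has a subcover of cardinality $<\kappa$. **Theorem.** Let $X$ be a topological space and let $\kappa$ be a regular (in particular infinite) cardinal that is a metrizable gauge of $X$. Then the following statements are equivalent. 1. $X$ is finally $\kappa$-compact. 2. There exists $G\in\mathcal G_\kappa$ such that $(X,d)$ is complete for all $d\in\mathrm{Met}(X;G)$. 3. For all $G\in\mathcal G_\kappa$ and all $d\in\mathrm{Met}(X;G)$, $(X,d)$ is complete. 4. There exists $S\in\mathcal F_\kappa$ such that $(X,d)$ is complete for all $d\in\mathrm{Ult}(X;S)$.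 5. For all $S\in\mathcal F_\kappa$ and all $d\in\mathrm{Ult}(X;S)$, $(X,d)$ is complete. -/

import Mathlib

universe u

open Set Filter Topology

section GaugeDefs

/-- The character `χ(S)` of a linearly ordered set `S` with least element `⊥`: the least cardinal
`κ > 0` for which there is a strictly decreasing map `f : κ + 1 → S` with `f κ = ⊥` such that every
`t ≠ ⊥` of `S` lies above some `f α` with `α < κ`. As usual a cardinal is identified with its
initial ordinal; only the values of `f` at ordinals `≤ κ` matter. -/
noncomputable def character (S : Type u) [LinearOrder S] [OrderBot S] : Cardinal.{u} :=
  sInf {κ : Cardinal.{u} | 0 < κ ∧ ∃ f : Ordinal.{u} → S,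
    (∀ α β : Ordinal.{u}, α < β → β ≤ κ.ord → f β < f α) ∧
    f κ.ord = ⊥ ∧
    ∀ t : S, t ≠ ⊥ → ∃ α : Ordinal.{u}, α < κ.ord ∧ f α ≤ t}

/-- The linearly ordered set of Archimedean classes of positive elements of `G`, in which the
class of `x` is below the class of `y` iff `x ≪ y` or `x ≍ y`. Mathlib's `FiniteArchimedeanClass G`
is the set of Archimedean classes of nonzero elements (`x` and `-x` share a class), with the
opposite order. -/
abbrev Arc (G : Type u) [AddCommGroup G] [LinearOrder G] [IsOrderedAddMonoid G] : Type u :=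
  (FiniteArchimedeanClass G)ᵒᵈ

/-- `G ∈ 𝒢_κ`: adjoining a new least element to the set of Archimedean classes of `G` gives
a set of character `κ`. -/
def InGClass (κ : Cardinal.{u}) (G : Type u) [AddCommGroup G] [LinearOrder G]
    [IsOrderedAddMonoid G] : Prop :=
  character (WithBot (Arc G)) = κ

/-- `S ∈ ℱ_κ`. -/
def InFClass (κ : Cardinal.{u}) (S : Type u) [LinearOrder S] [OrderBot S] : Prop :=
  character S = κ

/-- `d` is a `G`-metric on the set `X`. -/
structure IsGMetric {X G : Type u} [AddCommGroup G] [LinearOrder G]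
    (d : X → X → G) : Prop where
  eq_of_eq_zero : ∀ x y, d x y = 0 → x = y
  self_eq_zero : ∀ x, d x x = 0
  nonneg : ∀ x y, 0 ≤ d x y
  symmetric : ∀ x y, d x y = d y x
  triangle : ∀ x y z, d x y ≤ d x z + d z y

/-- `d` is an `S`-ultrametric on the set `X`. -/
structure IsSUltrametric {X S : Type u} [LinearOrder S] [OrderBot S]
    (d : X → X → S) : Prop where
  eq_of_eq_bot : ∀ x y, d x y = ⊥ → x = y
  self_eq_bot : ∀ x, d x x = ⊥
  nonneg : ∀ x y, ⊥ ≤ d x y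
  symmetric : ∀ x y, d x y = d y x
  strong_triangle : ∀ x y z, d x y ≤ max (d x z) (d z y)

/-- The topology generated by the open balls `{x | d a x < r}`, `r > o`, where `o` is the zero
of the value set (`0` for `G`-metrics, `⊥` for `S`-ultrametrics). -/
abbrev ballTopology {X V : Type u} [LinearOrder V] (o : V) (d : X → X → V) : TopologicalSpace X :=
  TopologicalSpace.generateFrom {U | ∃ (a : X) (r : V), o < r ∧ U = {x | d a x < r}}

/-- `F` is a Cauchy filter for `d`, where `o` is the zero of the value set. -/
def IsCauchyFilter {X V : Type u} [LinearOrder V] (o : V) (d : X → X → V) (F : Filter X) : Prop :=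
  F.NeBot ∧ ∀ ε : V, o < ε → ∃ A ∈ F, ∀ x ∈ A, ∀ y ∈ A, d x y < ε

/-- Every Cauchy filter for `d` converges in the topological space `X`. -/
def IsCompleteFor {X V : Type u} [TopologicalSpace X] [LinearOrder V] (o : V)
    (d : X → X → V) : Prop :=
  ∀ F : Filter X, IsCauchyFilter o d F → ∃ p : X, F ≤ 𝓝 p

/-- `Met(X; G)`: the `G`-metrics that generate the topology of `X`. -/
def Met (X G : Type u) [t : TopologicalSpace X] [AddCommGroup G] [LinearOrder G] :
    Set (X → X → G) :=
  {d | IsGMetric d ∧ ballTopology (0 : G) d = t}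

/-- `Ult(X; S)`: the `S`-ultrametrics that generate the topology of `X`. -/
def Ult (X S : Type u) [t : TopologicalSpace X] [LinearOrder S] [OrderBot S] :
    Set (X → X → S) :=
  {d | IsSUltrametric d ∧ ballTopology (⊥ : S) d = t}

/-- `κ` is a metrizable gauge of `X`. -/
def IsMetrizableGauge (X : Type u) [TopologicalSpace X] (κ : Cardinal.{u}) : Prop :=
  ∃ (G : Type u) (_ : AddCommGroup G) (_ : LinearOrder G) (_ : IsOrderedAddMonoid G),
    InGClass κ G ∧ (Met X G).Nonempty

/-- Every open cover of `X` has a subcover of cardinality `< κ`. -/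
def FinallyCompact (X : Type u) [TopologicalSpace X] (κ : Cardinal.{u}) : Prop :=
  ∀ 𝒰 : Set (Set X), (∀ U ∈ 𝒰, IsOpen U) → ⋃₀ 𝒰 = univ →
    ∃ 𝒱 : Set (Set X), 𝒱 ⊆ 𝒰 ∧ Cardinal.mk 𝒱 < κ ∧ ⋃₀ 𝒱 = univ

end GaugeDefs

/-! Completeness depends only on which sets are small, and for gauge `κ` smallness can be measured
by ordinals up to `κ.ord`. The Archimedean class of a `G`-metric is an ultrametric, because a sum
has at most the larger class of its terms. Ranking an ultrametric along a coinitial chain of length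
`κ` gives an ordinal gauge. Conversely, composing a gauge with a chain in any `S` or `G` of the
right character gives a distance with the same topology and Cauchy filters. So it suffices to treat
gauges.

If `X` is finally `κ`-compact, a Cauchy filter without limit yields an open cover indexed by
ordinals below `κ.ord`; by regularity a small subcover uses bounded indices, which contradicts the
Cauchy property (`IsOrdinalGauge.exists_le_nhds`). If not, a bad cover is refined to a partition
into at least `κ` balls, hence a locally constant map `h` onto `κ`. Shrinking the tails of `h` keeps
the topology but makes them a Cauchy filter without limit
(`IsOrdinalGauge.exists_isGaugeCauchy_not_le_nhds`). -/

/-! ### Ordinal gauges, character maps and ranks -/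

/-- An ultrametric with values in the reversed ordinal `o + 1`, inducing the topology of `X`:
larger values of `N` mean that points are closer, and `N x y = o` means `x = y`. -/
structure IsOrdinalGauge {X : Type u} [TopologicalSpace X] (o : Ordinal.{u})
    (N : X → X → Ordinal.{u}) : Prop where
  le : ∀ x y, N x y ≤ o
  self : ∀ x, N x x = o
  eq_of_eq : ∀ x y, N x y = o → x = y
  symm : ∀ x y, N x y = N y x
  min_le : ∀ x y z, min (N x z) (N z y) ≤ N x y
  isOpen_iff : ∀ U : Set X, IsOpen U ↔ ∀ x ∈ U, ∃ α < o, ∀ y, α ≤ N x y → y ∈ U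

/-- `F` contains sets that are arbitrarily small for the ordinal gauge `N`. -/
def IsGaugeCauchy {X : Type u} (o : Ordinal.{u}) (N : X → X → Ordinal.{u}) (F : Filter X) : Prop :=
  F.NeBot ∧ ∀ α < o, ∃ A ∈ F, ∀ x ∈ A, ∀ y ∈ A, α ≤ N x y

/-- A strictly decreasing map on `o + 1` that ends in `b` and is coinitial above `b`. -/
structure IsCharacterMap {V : Type u} [LinearOrder V] (o : Ordinal.{u}) (b : V)
    (f : Ordinal.{u} → V) : Prop where
  lt : ∀ α β : Ordinal.{u}, α < β → β ≤ o → f β < f α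
  apply_end : f o = b
  coinitial : ∀ t : V, b < t → ∃ α < o, f α ≤ t

theorem IsCharacterMap.le {V : Type u} [LinearOrder V] {o : Ordinal.{u}} {b : V}
    {f : Ordinal.{u} → V} (hf : IsCharacterMap o b f) {α β : Ordinal.{u}} (h : α ≤ β)
    (hβ : β ≤ o) : f β ≤ f α := by
  rcases h.eq_or_lt with rfl | h
  · exact le_rfl
  · exact (hf.lt α β h hβ).le

theorem IsCharacterMap.lt_iff {V : Type u} [LinearOrder V] {o : Ordinal.{u}} {b : V}
    {f : Ordinal.{u} → V} (hf : IsCharacterMap o b f) {α β : Ordinal.{u}} (hα : α ≤ o)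
    (hβ : β ≤ o) : f β < f α ↔ α < β :=
  ⟨fun h => lt_of_not_ge fun h' => (hf.le h' hα).not_gt h, fun h => hf.lt α β h hβ⟩

theorem IsCharacterMap.end_lt {V : Type u} [LinearOrder V] {o : Ordinal.{u}} {b : V}
    {f : Ordinal.{u} → V} (hf : IsCharacterMap o b f) {α : Ordinal.{u}} (hα : α < o) :
    b < f α := by
  have := hf.lt α o hα le_rfl
  rwa [hf.apply_end] at this

/-- Only attainment of the infimum is used; the minimality of the character plays no role. -/
theorem exists_isCharacterMap {S : Type u} [LinearOrder S] [OrderBot S] {κ : Cardinal.{u}}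
    (hκ : 0 < κ) (h : character S = κ) : ∃ f : Ordinal.{u} → S, IsCharacterMap κ.ord ⊥ f := by
  have hne : {κ : Cardinal.{u} | 0 < κ ∧ ∃ f : Ordinal.{u} → S,
      (∀ α β : Ordinal.{u}, α < β → β ≤ κ.ord → f β < f α) ∧
      f κ.ord = ⊥ ∧
      ∀ t : S, t ≠ ⊥ → ∃ α : Ordinal.{u}, α < κ.ord ∧ f α ≤ t}.Nonempty := by
    -- An empty infimum of cardinals is `0`, which `0 < κ` excludes.
    rw [Set.nonempty_iff_ne_empty]
    intro he
    rw [character, he, Cardinal.sInf_empty] at h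
    exact hκ.ne h
  have hm := csInf_mem hne
  rw [character] at h
  rw [h] at hm
  obtain ⟨-, f, h1, h2, h3⟩ := hm
  exact ⟨f, h1, h2, fun t ht => h3 t ht.ne'⟩

/-- The first ordinal at which `f` drops to `s` or below. -/
noncomputable def dropRank {S : Type u} [LinearOrder S] (f : Ordinal.{u} → S) (s : S) :
    Ordinal.{u} :=
  sInf {α | f α ≤ s}

section dropRank

variable {S : Type u} [LinearOrder S] [OrderBot S] {o : Ordinal.{u}} {f : Ordinal.{u} → S}

theorem IsCharacterMap.apply_dropRank_le (hf : IsCharacterMap o ⊥ f) (s : S) :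
    f (dropRank f s) ≤ s :=
  csInf_mem (s := {α | f α ≤ s}) ⟨o, by simp [hf.apply_end]⟩

theorem IsCharacterMap.dropRank_le (hf : IsCharacterMap o ⊥ f) (s : S) : dropRank f s ≤ o :=
  csInf_le' (by simp [hf.apply_end])

theorem IsCharacterMap.lt_dropRank_iff (hf : IsCharacterMap o ⊥ f) {α : Ordinal.{u}}
    (hα : α ≤ o) (s : S) : α < dropRank f s ↔ s < f α := by
  constructor
  · intro h
    by_contra! h'
    exact h.not_ge (csInf_le' h')
  · intro h
    exact (hf.lt_iff hα (hf.dropRank_le s)).1 ((hf.apply_dropRank_le s).trans_lt h)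

theorem IsCharacterMap.dropRank_eq_iff (hf : IsCharacterMap o ⊥ f) (s : S) :
    dropRank f s = o ↔ s = ⊥ := by
  constructor
  · intro h
    by_contra hs
    obtain ⟨α, hα, hαs⟩ := hf.coinitial s (bot_lt_iff_ne_bot.2 hs)
    exact hα.not_ge (h ▸ csInf_le' hαs)
  · rintro rfl
    refine (hf.dropRank_le ⊥).antisymm (le_of_not_gt fun h => ?_)
    exact (hf.end_lt h).not_ge (hf.apply_dropRank_le ⊥)

theorem IsCharacterMap.dropRank_anti (hf : IsCharacterMap o ⊥ f) {s t : S} (h : s ≤ t) :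
    dropRank f t ≤ dropRank f s :=
  csInf_le' (by simpa using (hf.apply_dropRank_le s).trans h)

end dropRank

/-! ### Ball topologies and the gauge of a distance -/

/-- If the open balls are neighbourhoods of their points, the topology they generate consists of
the sets that contain a ball around each of their points. -/
theorem isOpen_ballTopology_iff {X V : Type u} [LinearOrder V] {b : V} {d : X → X → V}
    (hself : ∀ x, d x x = b) (hb : ∃ r, b < r)
    (hball : ∀ a r x, d a x < r → ∃ s, b < s ∧ ∀ y, d x y < s → d a y < r) (U : Set X) :
    IsOpen[ballTopology b d] U ↔ ∀ x ∈ U, ∃ r, b < r ∧ ∀ y, d x y < r → y ∈ U := by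
  constructor
  · intro h
    induction h with
    | basic U hU =>
      obtain ⟨a, r, -, rfl⟩ := hU
      exact fun x hx => hball a r x hx
    | univ => exact fun x _ => hb.imp fun r hr => ⟨hr, fun _ _ => mem_univ _⟩
    | inter U V _ _ hU hV =>
      intro x hx
      obtain ⟨r, hr, hrU⟩ := hU x hx.1
      obtain ⟨s, hs, hsV⟩ := hV x hx.2
      exact ⟨min r s, lt_min hr hs, fun y hy =>
        ⟨hrU y (hy.trans_le (min_le_left _ _)), hsV y (hy.trans_le (min_le_right _ _))⟩⟩
    | sUnion 𝒰 _ ih =>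
      rintro x ⟨U, hU, hxU⟩
      obtain ⟨r, hr, hrU⟩ := ih U hU x hxU
      exact ⟨r, hr, fun y hy => ⟨U, hU, hrU y hy⟩⟩
  · intro h
    have : Nonempty V := ⟨b⟩
    choose! r hr hrU using h
    have hUeq : U = ⋃₀ {W | ∃ x ∈ U, W = {y | d x y < r x}} := by
      ext y
      constructor
      · intro hy
        exact ⟨_, ⟨y, hy, rfl⟩, by simpa [hself] using hr y hy⟩
      · rintro ⟨_, ⟨x, hx, rfl⟩, hy⟩
        exact hrU x hx y hy
    rw [hUeq]
    refine TopologicalSpace.GenerateOpen.sUnion _ ?_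
    rintro _ ⟨x, hx, rfl⟩
    exact TopologicalSpace.GenerateOpen.basic _ ⟨x, r x, hr x hx, rfl⟩

theorem IsSUltrametric.exists_ball_subset {X S : Type u} [LinearOrder S] [OrderBot S]
    {d : X → X → S} (hd : IsSUltrametric d) (a : X) (r : S) (x : X) (hx : d a x < r) :
    ∃ s, ⊥ < s ∧ ∀ y, d x y < s → d a y < r :=
  ⟨r, bot_le.trans_lt hx, fun y hy => (hd.strong_triangle a y x).trans_lt (max_lt hx hy)⟩

theorem IsGMetric.exists_ball_subset {X G : Type u} [AddCommGroup G] [LinearOrder G]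
    [IsOrderedAddMonoid G] {d : X → X → G} (hd : IsGMetric d) (a : X) (r : G) (x : X)
    (hx : d a x < r) : ∃ s, 0 < s ∧ ∀ y, d x y < s → d a y < r :=
  ⟨r - d a x, sub_pos.2 hx, fun y hy =>
    (hd.triangle a y x).trans_lt (by rwa [lt_sub_iff_add_lt'] at hy)⟩

/-- Composing the distance `d` with a valuation `c` into a set with a character map gives an
ordinal gauge, if `c` and `d` define the same small sets. -/
theorem isOrdinalGauge_dropRank {X V S : Type u} [t : TopologicalSpace X] [LinearOrder V]
    [LinearOrder S] [OrderBot S] {o : Ordinal.{u}} (ho : Order.IsSuccLimit o)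
    {f : Ordinal.{u} → S}
    (hf : IsCharacterMap o ⊥ f) {b : V} {d : X → X → V} (c : V → S)
    (hself : ∀ x, d x x = b) (hb : ∃ r, b < r)
    (hball : ∀ a r x, d a x < r → ∃ s, b < s ∧ ∀ y, d x y < s → d a y < r)
    (ht : ballTopology b d = t)
    (hcd : IsSUltrametric fun x y => c (d x y))
    (hc : ∀ α < o, ∃ r, b < r ∧ ∀ x y, d x y < r → c (d x y) < f α)
    (hr : ∀ r, b < r → ∃ α < o, ∀ x y, c (d x y) < f α → d x y < r) :
    IsOrdinalGauge o (fun x y => dropRank f (c (d x y))) ∧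
      ∀ F : Filter X, IsCauchyFilter b d F →
        IsGaugeCauchy o (fun x y => dropRank f (c (d x y))) F := by
  refine ⟨⟨fun x y => hf.dropRank_le _, fun x => ?_, fun x y h => ?_, fun x y => ?_,
    fun x y z => ?_, fun U => ?_⟩, fun F hF => ⟨hF.1, fun α hα => ?_⟩⟩
  · exact (hf.dropRank_eq_iff _).2 (hcd.self_eq_bot x)
  · exact hcd.eq_of_eq_bot x y ((hf.dropRank_eq_iff _).1 h)
  · exact congrArg (dropRank f) (hcd.symmetric x y)
  · rcases le_max_iff.1 (hcd.strong_triangle x y z) with h | h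
    · exact (min_le_left _ _).trans (hf.dropRank_anti h)
    · exact (min_le_right _ _).trans (hf.dropRank_anti h)
  · subst ht
    rw [isOpen_ballTopology_iff hself hb hball]
    refine forall₂_congr fun x _ => ⟨?_, ?_⟩
    · rintro ⟨r, hbr, h⟩
      obtain ⟨α, hα, hαr⟩ := hr r hbr
      -- Rank at least `succ α` means a value strictly below `f α`; `succ α` is still below the
      -- limit `o`.
      refine ⟨Order.succ α, ho.succ_lt hα, fun y hy => h y (hαr x y ?_)⟩
      exact (hf.lt_dropRank_iff hα.le _).1 (Order.succ_le_iff.1 hy)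
    · rintro ⟨α, hα, h⟩
      obtain ⟨r, hbr, hrα⟩ := hc α hα
      exact ⟨r, hbr, fun y hy => h y ((hf.lt_dropRank_iff hα.le _).2 (hrα x y hy)).le⟩
  · obtain ⟨r, hbr, hrα⟩ := hc α hα
    obtain ⟨A, hA, hAr⟩ := hF.2 r hbr
    exact ⟨A, hA, fun x hx y hy =>
      ((hf.lt_dropRank_iff hα.le _).2 (hrα x y (hAr x hx y hy))).le⟩

theorem exists_isOrdinalGauge_of_mem_ult {X S : Type u} [TopologicalSpace X] [LinearOrder S]
    [OrderBot S] {o : Ordinal.{u}} (ho : Order.IsSuccLimit o) {f : Ordinal.{u} → S}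
    (hf : IsCharacterMap o ⊥ f) {d : X → X → S} (hd : d ∈ Ult X S) :
    ∃ N : X → X → Ordinal.{u}, IsOrdinalGauge o N ∧
      ∀ F : Filter X, IsCauchyFilter ⊥ d F → IsGaugeCauchy o N F :=
  ⟨_, isOrdinalGauge_dropRank ho hf id hd.1.self_eq_bot ⟨f 0, hf.end_lt ho.bot_lt⟩
    hd.1.exists_ball_subset hd.2 hd.1
    (fun α hα => ⟨f α, hf.end_lt hα, fun _ _ h => h⟩)
    (fun r hr => (hf.coinitial r hr).imp fun _ h => ⟨h.1, fun _ _ h' => h'.trans_le h.2⟩)⟩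

/-! ### Archimedean classes of distances -/

section Arc

variable {G : Type u} [AddCommGroup G] [LinearOrder G] [IsOrderedAddMonoid G]

open Classical in
/-- The Archimedean class of an element of `G`, where `0` has class `⊥`. -/
noncomputable def arcClass (v : G) : WithBot (Arc G) :=
  if h : v = 0 then ⊥ else ↑(OrderDual.toDual (FiniteArchimedeanClass.mk v h))

theorem arcClass_eq_bot_iff {v : G} : arcClass v = ⊥ ↔ v = 0 := by
  by_cases h : v = 0 <;> simp [arcClass, h]

theorem arcClass_le_iff {v w : G} :
    arcClass v ≤ arcClass w ↔ ArchimedeanClass.mk w ≤ ArchimedeanClass.mk v := by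
  by_cases hv : v = 0
  · simp [arcClass, hv]
  by_cases hw : w = 0
  · simp [arcClass, hv, hw]
  · simp [arcClass, hv, hw, FiniteArchimedeanClass.mk_le_mk]

theorem arcClass_mono {v w : G} (hv : 0 ≤ v) (h : v ≤ w) : arcClass v ≤ arcClass w :=
  arcClass_le_iff.2 (ArchimedeanClass.mk_antitoneOn hv (hv.trans h) h)

theorem lt_of_arcClass_lt {v w : G} (hw : 0 ≤ w) (h : arcClass v < arcClass w) : v < w := by
  rw [← not_le, arcClass_le_iff, not_le] at h
  exact ArchimedeanClass.lt_of_mk_lt_mk_of_nonneg h hw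

theorem arcClass_add_le (v w : G) : arcClass (v + w) ≤ max (arcClass v) (arcClass w) := by
  simp only [le_max_iff, arcClass_le_iff]
  exact min_le_iff.1 (ArchimedeanClass.min_le_mk_add v w)

theorem exists_nonneg_arcClass_eq (t : WithBot (Arc G)) : ∃ v : G, 0 ≤ v ∧ arcClass v = t := by
  induction t with
  | bot => exact ⟨0, le_rfl, arcClass_eq_bot_iff.2 rfl⟩
  | coe t =>
    induction t using OrderDual.rec with
    | toDual t =>
      induction t using FiniteArchimedeanClass.ind with
      | mk a ha =>
        refine ⟨|a|, abs_nonneg a, ?_⟩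
        have h : arcClass |a| = arcClass a := by
          apply le_antisymm <;> simp [arcClass_le_iff]
        rw [h]
        simp [arcClass, ha]

theorem IsGMetric.isSUltrametric_arcClass {X : Type u} {d : X → X → G} (hd : IsGMetric d) :
    IsSUltrametric fun x y => arcClass (d x y) where
  eq_of_eq_bot x y h := hd.eq_of_eq_zero x y (arcClass_eq_bot_iff.1 h)
  self_eq_bot x := arcClass_eq_bot_iff.2 (hd.self_eq_zero x)
  nonneg _ _ := bot_le
  symmetric x y := congrArg arcClass (hd.symmetric x y)
  strong_triangle x y z :=
    (arcClass_mono (hd.nonneg x y) (hd.triangle x y z)).trans (arcClass_add_le _ _)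

/-- Nonnegative representatives of a chain of classes form a chain in `G`, since a strict inequality
of classes forces one of elements. -/
theorem exists_isCharacterMap_zero {o : Ordinal.{u}} (ho : Order.IsSuccLimit o)
    {f : Ordinal.{u} → WithBot (Arc G)} (hf : IsCharacterMap o ⊥ f) :
    ∃ g : Ordinal.{u} → G, IsCharacterMap o 0 g ∧ ∀ α, arcClass (g α) = f α := by
  choose g hg0 hg using fun α => exists_nonneg_arcClass_eq (f α)
  refine ⟨g, ⟨fun α β h hβ => ?_, ?_, fun r hr => ?_⟩, hg⟩
  · exact lt_of_arcClass_lt (hg0 α) (by rw [hg, hg]; exact hf.lt α β h hβ)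
  · rw [← arcClass_eq_bot_iff, hg, hf.apply_end]
  · obtain ⟨α, hα, h⟩ := hf.coinitial (arcClass r)
      (bot_lt_iff_ne_bot.2 (mt arcClass_eq_bot_iff.1 hr.ne'))
    -- Equal classes do not order their representatives, so one more step makes the class strictly
    -- smaller than that of `r`.
    have hα' := ho.succ_lt hα
    refine ⟨Order.succ α, hα', (lt_of_arcClass_lt hr.le ?_).le⟩
    rw [hg]
    exact (hf.lt _ _ (Order.lt_succ α) hα'.le).trans_le h

theorem exists_isOrdinalGauge_of_mem_met {X : Type u} [TopologicalSpace X] {o : Ordinal.{u}}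
    (ho : Order.IsSuccLimit o) {f : Ordinal.{u} → WithBot (Arc G)} (hf : IsCharacterMap o ⊥ f)
    {d : X → X → G} (hd : d ∈ Met X G) :
    ∃ N : X → X → Ordinal.{u}, IsOrdinalGauge o N ∧
      ∀ F : Filter X, IsCauchyFilter 0 d F → IsGaugeCauchy o N F := by
  obtain ⟨g, hg, hgf⟩ := exists_isCharacterMap_zero ho hf
  refine ⟨_, isOrdinalGauge_dropRank ho hf arcClass hd.1.self_eq_zero
    ⟨g 0, hg.end_lt ho.bot_lt⟩ hd.1.exists_ball_subset hd.2 hd.1.isSUltrametric_arcClass ?_ ?_⟩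
  · intro α hα
    have hα' := ho.succ_lt hα
    refine ⟨g (Order.succ α), hg.end_lt hα', fun x y h => ?_⟩
    refine (arcClass_mono (hd.1.nonneg x y) h.le).trans_lt ?_
    rw [hgf]
    exact hf.lt _ _ (Order.lt_succ α) hα'.le
  · intro r hr
    obtain ⟨α, hα, h⟩ := hg.coinitial r hr
    refine ⟨α, hα, fun x y hxy => ?_⟩
    rw [← hgf] at hxy
    exact (lt_of_arcClass_lt (hg.end_lt hα).le hxy).trans_le h

end Arc

/-! ### Distances built from an ordinal gauge -/

section OfGauge

variable {X : Type u} {o : Ordinal.{u}} {N : X → X → Ordinal.{u}}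

theorem IsOrdinalGauge.ballTopology_comp {V : Type u} [t : TopologicalSpace X] [LinearOrder V]
    (hN : IsOrdinalGauge o N) (ho : Order.IsSuccLimit o) {b : V} {g : Ordinal.{u} → V}
    (hg : IsCharacterMap o b g)
    (hball : ∀ a r x, g (N a x) < r → ∃ s, b < s ∧ ∀ y, g (N x y) < s → g (N a y) < r) :
    ballTopology b (fun x y => g (N x y)) = t := by
  ext U
  rw [isOpen_ballTopology_iff (fun x => by rw [hN.self, hg.apply_end])
    ⟨g 0, hg.end_lt ho.bot_lt⟩ hball, hN.isOpen_iff]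
  refine forall₂_congr fun x _ => ⟨?_, ?_⟩
  · rintro ⟨r, hr, h⟩
    obtain ⟨α, hα, hαr⟩ := hg.coinitial r hr
    refine ⟨Order.succ α, ho.succ_lt hα, fun y hy => h y (lt_of_lt_of_le ?_ hαr)⟩
    exact hg.lt _ _ (Order.succ_le_iff.1 hy) (hN.le x y)
  · rintro ⟨α, hα, h⟩
    exact ⟨g α, hg.end_lt hα, fun y hy => h y ((hg.lt_iff hα.le (hN.le x y)).1 hy).le⟩

theorem IsGaugeCauchy.isCauchyFilter_comp {V : Type u} [TopologicalSpace X] [LinearOrder V]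
    {F : Filter X} (hF : IsGaugeCauchy o N F) (hN : IsOrdinalGauge o N)
    (ho : Order.IsSuccLimit o) {b : V} {g : Ordinal.{u} → V} (hg : IsCharacterMap o b g) :
    IsCauchyFilter b (fun x y => g (N x y)) F := by
  refine ⟨hF.1, fun r hr => ?_⟩
  obtain ⟨α, hα, hαr⟩ := hg.coinitial r hr
  obtain ⟨A, hA, h⟩ := hF.2 _ (ho.succ_lt hα)
  exact ⟨A, hA, fun x hx y hy => lt_of_lt_of_le
    (hg.lt _ _ (Order.succ_le_iff.1 (h x hx y hy)) (hN.le x y)) hαr⟩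

theorem IsOrdinalGauge.comp_le_max {V : Type u} [TopologicalSpace X] [LinearOrder V]
    (hN : IsOrdinalGauge o N) {b : V} {g : Ordinal.{u} → V} (hg : IsCharacterMap o b g)
    (x y z : X) : g (N x y) ≤ max (g (N x z)) (g (N z y)) := by
  rcases min_le_iff.1 (hN.min_le x y z) with h | h
  · exact le_max_of_le_left (hg.le h (hN.le x y))
  · exact le_max_of_le_right (hg.le h (hN.le x y))

theorem IsOrdinalGauge.eq_of_comp_eq {V : Type u} [TopologicalSpace X] [LinearOrder V]
    (hN : IsOrdinalGauge o N) {b : V} {g : Ordinal.{u} → V} (hg : IsCharacterMap o b g)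
    (x y : X) (h : g (N x y) = b) : x = y :=
  hN.eq_of_eq x y ((hN.le x y).eq_of_not_lt fun h' => (hg.end_lt h').ne' h)

theorem IsOrdinalGauge.comp_mem_ult {S : Type u} [TopologicalSpace X] [LinearOrder S]
    [OrderBot S] (hN : IsOrdinalGauge o N) (ho : Order.IsSuccLimit o) {f : Ordinal.{u} → S}
    (hf : IsCharacterMap o ⊥ f) : (fun x y => f (N x y)) ∈ Ult X S := by
  have h : IsSUltrametric fun x y => f (N x y) :=
    { eq_of_eq_bot := hN.eq_of_comp_eq hf
      self_eq_bot := fun x => by rw [hN.self, hf.apply_end]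
      nonneg := fun _ _ => bot_le
      symmetric := fun x y => by rw [hN.symm]
      strong_triangle := hN.comp_le_max hf }
  exact ⟨h, hN.ballTopology_comp ho hf h.exists_ball_subset⟩

theorem IsOrdinalGauge.comp_mem_met {G : Type u} [TopologicalSpace X] [AddCommGroup G]
    [LinearOrder G] [IsOrderedAddMonoid G] (hN : IsOrdinalGauge o N)
    (ho : Order.IsSuccLimit o) {g : Ordinal.{u} → G} (hg : IsCharacterMap o 0 g) :
    (fun x y => g (N x y)) ∈ Met X G := by
  have h0 : ∀ x y, 0 ≤ g (N x y) := fun x y => by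
    simpa only [hg.apply_end] using hg.le (hN.le x y) le_rfl
  have h : IsGMetric fun x y => g (N x y) :=
    { eq_of_eq_zero := hN.eq_of_comp_eq hg
      self_eq_zero := fun x => by rw [hN.self, hg.apply_end]
      nonneg := h0
      symmetric := fun x y => by rw [hN.symm]
      triangle := fun x y z => (hN.comp_le_max hg x y z).trans
        (max_le (le_add_of_nonneg_right (h0 z y)) (le_add_of_nonneg_left (h0 x z))) }
  exact ⟨h, hN.ballTopology_comp ho hg h.exists_ball_subset⟩

end OfGauge

/-! ### Final compactness and Cauchy filters of gauges -/

section Gauge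

variable {X : Type u} [TopologicalSpace X] {κ : Cardinal.{u}} {N : X → X → Ordinal.{u}}

theorem IsOrdinalGauge.exists_le_nhds (hκ : κ.IsRegular) (hN : IsOrdinalGauge κ.ord N)
    (hX : FinallyCompact X κ) {F : Filter X} (hF : IsGaugeCauchy κ.ord N F) :
    ∃ p, F ≤ 𝓝 p := by
  have := hF.1
  -- A point in every `B α` with `α < κ.ord` is a limit of `F`. By the strong triangle inequality
  -- the complements of these sets are open.
  set B : Ordinal.{u} → Set X := fun α => {x | ∀ᶠ y in F, α ≤ N x y} with hB
  by_contra! hcon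
  have hcover : ∀ x, ∃ α < κ.ord, x ∉ B α := by
    intro x
    by_contra! h
    refine hcon x (le_nhds_iff.2 fun U hxU hU => ?_)
    obtain ⟨α, hα, hαU⟩ := (hN.isOpen_iff U).1 hU x hxU
    exact Filter.mem_of_superset (h α hα) hαU
  obtain ⟨𝒱, h𝒱, hcard, hun⟩ := hX {U | ∃ α < κ.ord, U = (B α)ᶜ} (by
      rintro _ ⟨α, hα, rfl⟩
      rw [hN.isOpen_iff]
      refine fun x hx => ⟨α, hα, fun y hxy hy => hx ?_⟩
      filter_upwards [hy] with z hz
      exact (le_min hxy hz).trans (hN.min_le x z y)) (by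
      refine eq_univ_of_forall fun x => ?_
      obtain ⟨α, hα, hx⟩ := hcover x
      exact ⟨_, ⟨α, hα, rfl⟩, hx⟩)
  choose a ha haV using fun V : 𝒱 => h𝒱 V.2
  -- Regularity enters here. Any point of a set in `F` that is small at this level lies in all the
  -- chosen `B (a V)`, so the subcover misses it.
  have hsup : ⨆ V, a V < κ.ord :=
    Ordinal.iSup_lt_of_lt_cof (by rwa [hκ.cof_ord]) ha
  obtain ⟨A, hA, hAN⟩ := hF.2 _ hsup
  obtain ⟨x, hx⟩ := Filter.nonempty_of_mem hA
  obtain ⟨V, hV, hxV⟩ : x ∈ ⋃₀ 𝒱 := hun ▸ mem_univ x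
  have hxB : x ∉ B (a ⟨V, hV⟩) := (haV ⟨V, hV⟩).subset hxV
  refine hxB ?_
  filter_upwards [hA] with y hy
  exact (Ordinal.le_iSup a ⟨V, hV⟩).trans (hAN x hx y hy)

/-- Around each point take the ball of least index that fits inside a member of the cover. Every
point of a ball is a centre, so these balls partition `X`; fewer than `κ` of them would give a small
subcover. -/
theorem IsOrdinalGauge.exists_locallyConstant_unbounded (hκ : κ.IsRegular)
    (hN : IsOrdinalGauge κ.ord N) (hX : ¬ FinallyCompact X κ) :
    ∃ h : X → Ordinal.{u}, (∀ x, h x < κ.ord) ∧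
      (∀ x, ∃ α < κ.ord, ∀ y, α ≤ N x y → h y = h x) ∧ ∀ α < κ.ord, ∃ x, h x = α := by
  simp only [FinallyCompact, not_forall, not_exists, not_and] at hX
  obtain ⟨𝒰, hopen, hcov, h𝒰⟩ := hX
  set T : X → Set Ordinal.{u} := fun x =>
    {α | α < κ.ord ∧ ∃ U ∈ 𝒰, ∀ y, α ≤ N x y → y ∈ U} with hT
  have hTne : ∀ x, (T x).Nonempty := by
    intro x
    obtain ⟨U, hU, hxU⟩ : x ∈ ⋃₀ 𝒰 := hcov ▸ mem_univ x
    obtain ⟨α, hα, h⟩ := (hN.isOpen_iff U).1 (hopen U hU) x hxU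
    exact ⟨α, hα, U, hU, h⟩
  set a : X → Ordinal.{u} := fun x => sInf (T x) with ha
  have haT : ∀ x, a x ∈ T x := fun x => csInf_mem (hTne x)
  set P : X → Set X := fun x => {y | a x ≤ N x y} with hP
  have hale : ∀ x y, a x ≤ N x y → a y ≤ a x := by
    intro x y hxy
    obtain ⟨h1, U, hU, h2⟩ := haT x
    exact csInf_le' ⟨h1, U, hU, fun z hz => h2 z ((le_min hxy hz).trans (hN.min_le x z y))⟩
  have hPeq : ∀ x y, a x ≤ N x y → P y = P x := by
    intro x y hxy
    have hyx : a y ≤ N y x := by rw [hN.symm]; exact (hale x y hxy).trans hxy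
    have haa : a x = a y := (hale y x hyx).antisymm (hale x y hxy)
    ext z
    constructor
    · intro hz
      exact (le_min hxy (haa ▸ hz : a x ≤ N y z)).trans (hN.min_le x z y)
    · intro hz
      exact (le_min hyx (haa ▸ hz : a y ≤ N x z)).trans (hN.min_le y z x)
  have hcard : κ ≤ Cardinal.mk (range P) := by
    by_contra! hlt
    have hsub : ∀ p : range P, ∃ U ∈ 𝒰, p.1 ⊆ U := by
      rintro ⟨_, x, rfl⟩
      obtain ⟨-, U, hU, h⟩ := haT x
      exact ⟨U, hU, h⟩
    choose u hu hpu using hsub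
    refine h𝒰 (range u) (by rintro _ ⟨p, rfl⟩; exact hu p)
      (Cardinal.mk_range_le.trans_lt hlt) (eq_univ_of_forall fun x => ?_)
    exact ⟨_, ⟨⟨P x, x, rfl⟩, rfl⟩, hpu ⟨P x, x, rfl⟩
      (by simp only [hP, mem_ofPred_eq, hN.self]; exact (haT x).1.le)⟩
  rw [← κ.mk_ord_toType] at hcard
  obtain ⟨ι⟩ := hcard
  have : Nonempty κ.ord.ToType := Ordinal.nonempty_toType_iff.2 hκ.ord_pos.ne'
  -- A left inverse of an embedding of `κ` into the pieces maps the pieces onto `κ`.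
  let r : range P → κ.ord.ToType := Function.invFun ι
  refine ⟨fun x => (r ⟨P x, x, rfl⟩).toOrd, fun x => (r ⟨P x, x, rfl⟩).toOrd.2, fun x => ?_,
    fun α hα => ?_⟩
  · refine ⟨a x, (haT x).1, fun y hy => ?_⟩
    simp only [hPeq x y hy]
  · obtain ⟨⟨_, x, rfl⟩, hx⟩ := Function.invFun_surjective ι.injective (Ordinal.ToType.mk ⟨α, hα⟩)
    refine ⟨x, ?_⟩
    simp [r, hx]

/-- If `X` is not finally `κ`-compact, its topology has an ordinal gauge with a Cauchy filter that
does not converge: the tails of a locally constant map onto `κ` are made small. -/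
theorem IsOrdinalGauge.exists_isGaugeCauchy_not_le_nhds (hκ : κ.IsRegular)
    (hN : IsOrdinalGauge κ.ord N) (hX : ¬ FinallyCompact X κ) :
    ∃ M : X → X → Ordinal.{u}, IsOrdinalGauge κ.ord M ∧
      ∃ F : Filter X, IsGaugeCauchy κ.ord M F ∧ ∀ p, ¬ F ≤ 𝓝 p := by
  classical
  obtain ⟨h, hlt, hloc, hsurj⟩ := hN.exists_locallyConstant_unbounded hκ hX
  have ho : Order.IsSuccLimit κ.ord := Cardinal.isSuccLimit_ord hκ.aleph0_le
  -- Points with `h ≥ α` become `α`-close, by `hmin`. Beyond level `h x` nothing changes around `x`,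
  -- by `hMlt`, so the topology and separation of points survive.
  set M : X → X → Ordinal.{u} := fun x y =>
    if h x = h y then max (N x y) (h x) else min (h x) (h y) with hM
  have hMeq : ∀ x y, h x = h y → M x y = max (N x y) (h x) := fun x y e => if_pos e
  have hMne : ∀ x y, h x ≠ h y → M x y = min (h x) (h y) := fun x y e => if_neg e
  have hMlt : ∀ x y, h x < M x y → h x = h y ∧ M x y = N x y := by
    intro x y hxy
    by_cases e : h x = h y
    · rw [hMeq x y e] at hxy ⊢
      exact ⟨e, max_eq_left ((lt_max_iff.1 hxy).resolve_right (lt_irrefl _)).le⟩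
    · rw [hMne x y e] at hxy
      exact absurd (min_le_left _ _) hxy.not_ge
  have hmin : ∀ x y, min (h x) (h y) ≤ M x y := by
    intro x y
    by_cases e : h x = h y
    · rw [hMeq x y e]
      exact (min_le_left _ _).trans (le_max_right _ _)
    · rw [hMne x y e]
  have hgauge : IsOrdinalGauge κ.ord M := by
    refine ⟨fun x y => ?_, fun x => ?_, fun x y e => ?_, fun x y => ?_, fun x y z => ?_,
      fun U => ?_⟩
    · by_cases e : h x = h y
      · rw [hMeq x y e]
        exact max_le (hN.le x y) (hlt x).le
      · rw [hMne x y e]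
        exact (min_le_left _ _).trans (hlt x).le
    · rw [hMeq x x rfl, hN.self, max_eq_left (hlt x).le]
    · have := (hMlt x y (e ▸ hlt x)).2
      exact hN.eq_of_eq x y (this ▸ e)
    · by_cases e : h x = h y
      · rw [hMeq x y e, hMeq y x e.symm, hN.symm, e]
      · rw [hMne x y e, hMne y x (Ne.symm e), min_comm]
    · by_cases exz : h x = h z
      · by_cases ezy : h z = h y
        · rw [hMeq x z exz, hMeq z y ezy, hMeq x y (exz.trans ezy), ← exz, ← max_min_distrib_right]
          exact max_le_max_right _ (hN.min_le x y z)
        · rw [hMne z y ezy, ← exz]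
          exact (min_le_right _ _).trans (hmin x y)
      · by_cases ezy : h z = h y
        · rw [hMne x z exz, ezy]
          exact (min_le_left _ _).trans (hmin x y)
        · rw [hMne x z exz, hMne z y ezy]
          exact (min_le_min (min_le_left _ _) (min_le_right _ _)).trans (hmin x y)
    · rw [hN.isOpen_iff]
      refine forall₂_congr fun x _ => ⟨?_, ?_⟩
      · rintro ⟨α, hα, hU⟩
        refine ⟨max α (Order.succ (h x)), max_lt hα (ho.succ_lt (hlt x)), fun y hy => hU y ?_⟩
        rw [max_le_iff, Order.succ_le_iff] at hy
        exact (hMlt x y hy.2).2 ▸ hy.1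
      · rintro ⟨α, hα, hU⟩
        obtain ⟨β, hβ, hβh⟩ := hloc x
        refine ⟨max α β, max_lt hα hβ, fun y hy => hU y ?_⟩
        rw [max_le_iff] at hy
        rw [hMeq x y (hβh y hy.2).symm]
        exact hy.1.trans (le_max_left _ _)
  have hne : (⨅ α : Iio κ.ord, 𝓟 {x | α.1 ≤ h x}).NeBot := by
    have : Nonempty (Iio κ.ord) := ⟨⟨0, hκ.ord_pos⟩⟩
    refine Filter.iInf_neBot_of_directed' ?_ fun α => ?_
    · intro α β
      refine ⟨max α β, ?_, ?_⟩ <;> refine Filter.principal_mono.2 fun x hx => ?_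
      · exact le_trans (Subtype.coe_le_coe.2 (le_max_left α β)) hx
      · exact le_trans (Subtype.coe_le_coe.2 (le_max_right α β)) hx
    · rw [Filter.principal_neBot_iff]
      obtain ⟨x, hx⟩ := hsurj α.1 α.2
      exact ⟨x, hx.ge⟩
  refine ⟨M, hgauge, ⨅ α : Iio κ.ord, 𝓟 {x | α.1 ≤ h x}, ⟨hne, fun α hα => ?_⟩, fun p hp => ?_⟩
  · exact ⟨_, Filter.mem_iInf_of_mem ⟨α, hα⟩ (Filter.mem_principal_self _),
      fun x hx y hy => (le_min hx hy).trans (hmin x y)⟩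
  · have hU : IsOpen {x | h x = h p} := (hN.isOpen_iff _).2 fun x hx => by
      obtain ⟨α, hα, hαh⟩ := hloc x
      exact ⟨α, hα, fun y hy => (hαh y hy).trans hx⟩
    have h1 := hp (hU.mem_nhds rfl)
    have h2 : {x | Order.succ (h p) ≤ h x} ∈ ⨅ α : Iio κ.ord, 𝓟 {x | α.1 ≤ h x} :=
      Filter.mem_iInf_of_mem ⟨_, ho.succ_lt (hlt p)⟩ (Filter.mem_principal_self _)
    obtain ⟨x, hx1, hx2⟩ := Filter.nonempty_of_mem (Filter.inter_mem h1 h2)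
    exact (Order.succ_le_iff.1 hx2).ne' hx1

end Gauge

/-! ### The equivalences -/

theorem mainTheorem5 (X : Type u) [TopologicalSpace X] (κ : Cardinal.{u})
    (hreg : κ.IsRegular) (hκ : IsMetrizableGauge X κ) :
    List.TFAE [
      FinallyCompact X κ,
      ∃ (G : Type u) (_ : AddCommGroup G) (_ : LinearOrder G) (_ : IsOrderedAddMonoid G),
        InGClass κ G ∧ ∀ d ∈ Met X G, IsCompleteFor (0 : G) d,
      ∀ (G : Type u) [AddCommGroup G] [LinearOrder G] [IsOrderedAddMonoid G],
        InGClass κ G → ∀ d ∈ Met X G, IsCompleteFor (0 : G) d,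
      ∃ (S : Type u) (_ : LinearOrder S) (_ : OrderBot S),
        InFClass κ S ∧ ∀ d ∈ Ult X S, IsCompleteFor (⊥ : S) d,
      ∀ (S : Type u) [LinearOrder S] [OrderBot S],
        InFClass κ S → ∀ d ∈ Ult X S, IsCompleteFor (⊥ : S) d] := by
  have ho : Order.IsSuccLimit κ.ord := Cardinal.isSuccLimit_ord hreg.aleph0_le
  obtain ⟨G₀, _, _, _, hG₀, d₀, hd₀⟩ := hκ
  obtain ⟨f₀, hf₀⟩ := exists_isCharacterMap hreg.pos hG₀
  obtain ⟨N, hN, -⟩ := exists_isOrdinalGauge_of_mem_met ho hf₀ hd₀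
  tfae_have 1 → 3 := by
    intro hX G _ _ _ hG d hd F hF
    obtain ⟨f, hf⟩ := exists_isCharacterMap hreg.pos hG
    obtain ⟨N, hN, hNF⟩ := exists_isOrdinalGauge_of_mem_met ho hf hd
    exact hN.exists_le_nhds hreg hX (hNF F hF)
  tfae_have 1 → 5 := by
    intro hX S _ _ hS d hd F hF
    obtain ⟨f, hf⟩ := exists_isCharacterMap hreg.pos hS
    obtain ⟨N, hN, hNF⟩ := exists_isOrdinalGauge_of_mem_ult ho hf hd
    exact hN.exists_le_nhds hreg hX (hNF F hF)
  tfae_have 3 → 2 := fun h => ⟨G₀, _, _, _, hG₀, h G₀ hG₀⟩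
  -- The Archimedean classes of the given group, with a bottom adjoined, witness that `ℱ_κ` is
  -- nonempty.
  tfae_have 5 → 4 := fun h => ⟨WithBot (Arc G₀), _, _, hG₀, h _ hG₀⟩
  tfae_have 2 → 1 := by
    rintro ⟨G, _, _, _, hG, h⟩
    by_contra hX
    obtain ⟨M, hM, F, hF, hFp⟩ := hN.exists_isGaugeCauchy_not_le_nhds hreg hX
    obtain ⟨f, hf⟩ := exists_isCharacterMap hreg.pos hG
    obtain ⟨g, hg, -⟩ := exists_isCharacterMap_zero ho hf
    obtain ⟨p, hp⟩ := h _ (hM.comp_mem_met ho hg) F (hF.isCauchyFilter_comp hM ho hg)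
    exact hFp p hp
  tfae_have 4 → 1 := by
    rintro ⟨S, _, _, hS, h⟩
    by_contra hX
    obtain ⟨M, hM, F, hF, hFp⟩ := hN.exists_isGaugeCauchy_not_le_nhds hreg hX
    obtain ⟨f, hf⟩ := exists_isCharacterMap hreg.pos hS
    obtain ⟨p, hp⟩ := h _ (hM.comp_mem_ult ho hf) F (hF.isCauchyFilter_comp hM ho hf)
    exact hFp p hp
  tfae_finish
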